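/- **Setting.** Let $\Sigma^-,\Sigma^+$ be finite alphabets. A $\lambda$-graph bisystem $(\mathfrak L^-,\mathfrak L^+)$ over $\Sigma^\pm$ is a pair of labeled Bratteli diagrams $\mathfrak L^-=(V,E^-,\lambda^-)$, $\mathfrak L^+=(V,E^+,\lambda^+)$ with common vertex set $V=\bigsqcup_{l\ge0}V_l$ and edge sets $E^-=\bigsqcup_{l\ge 0} E^-_{l+1,l}$, $E^+=\bigsqcup_{l\ge 0} E^+_{l,l+1}$ (all $V_l$, $E^-_{l+1,l}$, $E^+_{l,l+1}$ finite) and labelings $\lambda^\pm:E^\pm\to\Sigma^\pm$, such that - edges in $E^-_{l+1,l}$ have source in $V_{l+1}$ and terminal in $V_l$; edges in $E^+_{l,l+1}$ have source in $V_l$ and terminal in $V_{l+1}$; - every $v\in V_l$ is the terminal of an edge in $E^-_{l+1,l}$ and the source of an edge in $E^+_{l,l+1}$, and, if $l\ge1$, also the source of an edge in $E^-_{l,l-1}$ and the terminal of an edge in $E^+_{l-1,l}$; - an edge of $E^-$ is determined by its source and label, and an edge of $E^+$ by its terminal and label; - for $u\in V_l$, $v\in V_{l+2}$ there is a label-preserving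 bijection $(e^-,e^+)\mapsto(f^+,f^-)$ (that is, $\lambda^-(e^-)=\lambda^-(f^-)$ and $\lambda^+(e^+)=\lambda^+(f^+)$) from the set of pairs in $E^-_{l+1,l}\times E^+_{l+1,l+2}$ with $t(e^-)=u$, $s(e^-)=s(e^+)$, $t(e^+)=v$ onto the set of pairs in $E^+_{l,l+1}\times E^-_{l+2,l+1}$ with $s(f^+)=u$, $t(f^+)=t(f^-)$, $s(f^-)=v$. Let $\Omega_{\mathfrak L^-}$ be the compact space of sequences $\omega=(u_l,\beta_{-l})_{l\ge1}$ of vertices $u_l\in V_l$ and labels coming from infinite paths $\cdots\to u_2\xrightarrow{\beta_{-2}}u_1\xrightarrow{\beta_{-1}}u_0$ in $\mathfrak L^-$ (the vertex $u_0$ is determined by $\omega$). Let $E^+_{\mathfrak L^-}$ be the set of $(\omega,\alpha,\omega')\in\Omega_{\mathfrak L^-}\times\Sigma^+\times\Omega_{\mathfrak L^-}$ with $\omega=(u_l,\beta_{-l})_{l\ge 1}$, $\omega'=(u'_l,\beta_{-l+1})_{l\ge 1}$ such that for every $l\ge0$ there is an edge in $E^+_{l,l+1}$ labeled $\alpha$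 from $u_l$ to $u'_{l+1}$. Let $X^+_{\mathfrak L^-}$ be the space of sequences $x=(\alpha_i,\omega^i)_{i\ge1}$ with $(\omega^{i},\alpha_{i+1},\omega^{i+1})\in E^+_{\mathfrak L^-}$ for all $i\ge1$ and $(\omega^0,\alpha_1,\omega^1)\in E^+_{\mathfrak L^-}$ for some (necessarily unique) $\omega^0=\omega^0(x)$, let $\sigma_{\mathfrak L^-}$ be its left shift, and let $\mathcal O^+_{\mathfrak L^-}$ be the $C^*$-algebra of the Deaconu–Renault groupoid $$\{(x,n,y)\mid \exists\,k,m\ge0:\ n=k-m,\ \sigma_{\mathfrak L^-}^k(x)=\sigma_{\mathfrak L^-}^m(y)\}.$$ It contains the elements $S_\alpha=\chi_{\{(x,1,\sigma_{\mathfrak L^-}(x))\,:\,\alpha_1(x)=\alpha\}}$ for $\alpha\in\Sigma^+$, and $E_v^{l-}(\xi)=\chi_{\{(x,0,x)\,:\,\omega^0(x)=(u_k,\beta_{-k})_k,\ u_l=v,\ (\beta_{-l},\dots,\beta_{-1})=\xi\}}$ for $l\ge 0$, $v\in V_l$, $\xi\in(\Sigma^-)^l$. Symmetrically, $\mathcal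 O^-_{\mathfrak L^+}$ is the $C^*$-algebra of the Deaconu–Renault groupoid of the shift on $X^-_{\mathfrak L^+}$, the space of sequences $(\beta_i,\omega^i)_{i\ge1}$ in $\Sigma^-\times\Omega_{\mathfrak L^+}$ with $(\omega^i,\beta_{i+1},\omega^{i+1})\in E^-_{\mathfrak L^+}$ for all $i\ge1$ and $(\omega^0,\beta_1,\omega^1)\in E^-_{\mathfrak L^+}$ for some $\omega^0$. Here $\Omega_{\mathfrak L^+}$ consists of the sequences $\omega=(\alpha_l,u_l)_{l\ge1}$ coming from paths $u_0\xrightarrow{\alpha_1}u_1\xrightarrow{\alpha_2}u_2\to\cdots$ in $\mathfrak L^+$, and $E^-_{\mathfrak L^+}$ of the $(\omega,\beta,\omega')$ with $\omega=(\alpha_l,u_l)_{l\ge 1}$, $\omega'=(\alpha_{l-1},u'_l)_{l\ge 1}$ such that for every $l\ge0$ there is an edge in $E^-_{l+1,l}$ labeled $\beta$ from $u'_{l+1}$ to $u_l$. It contains $T_\beta=\chi_{\{(x,1,\sigma_{\mathfrak L^+}(x))\,:\,\beta_1(x)=\beta\}}$ for $\beta\in\Sigma^-$, and $E_v^{l+}(\eta)=\chi_{\{(x,0,x)\,:\,\omega^0(x)=(\alpha_k,u_k)_k,\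 u_l=v,\ (\alpha_1,\dots,\alpha_l)=\eta\}}$ for $l\ge 0$, $v\in V_l$, $\eta\in(\Sigma^+)^l$. **Proposition.** Let $(\mathfrak L^-,\mathfrak L^+)$ be a $\lambda$-graph bisystem over $\Sigma^\pm$, and let $\mathfrak L^{-t}$, $\mathfrak L^{+t}$ be the labeled Bratteli diagrams obtained from $\mathfrak L^-$, $\mathfrak L^+$ by reversing all edges and keeping the labels. Then $(\mathfrak L^{+t},\mathfrak L^{-t})$ is a $\lambda$-graph bisystem (with upward diagram $\mathfrak L^{+t}$ over $\Sigma^+$ and downward diagram $\mathfrak L^{-t}$ over $\Sigma^-$), and there are canonical $*$-isomorphisms $$\Phi:\mathcal O^+_{\mathfrak L^-}\to\mathcal O^-_{\mathfrak L^{-t}},\qquad \Psi:\mathcal O^-_{\mathfrak L^+}\to\mathcal O^+_{\mathfrak L^{+t}},$$ where the two target algebras are those of the bisystem $(\mathfrak L^{+t},\mathfrak L^{-t})$. They are canonical in the sense that $$\Phi(S_\alpha)=T_\alpha,\quad \Phi(E_v^{l-}(\xi_1,\dots,\xi_l))=E_v^{l+}(\xi_l,\dots,\xi_1),\qquad \Psi(T_\beta)=S_\beta,\quad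 \Psi(E_v^{l+}(\eta_1,\dots,\eta_l))=E_v^{l-}(\eta_l,\dots,\eta_1)$$ for all $\alpha\in\Sigma^+$, $\beta\in\Sigma^-$, $l\ge0$, $v\in V_l$, $\xi\in(\Sigma^-)^l$, $\eta\in(\Sigma^+)^l$. -/

import Mathlib

universe u

noncomputable section

/-! ### Labeled Bratteli diagrams and `λ`-graph bisystems -/

/-- A labeled Bratteli diagram with upward edges over the alphabet `S`: an element of `Edge l`
is an edge of `E_{l+1,l}`, which goes from `V (l+1)` to `V l`. -/
structure UpwardDiagram (V : ℕ → Type u) (S : Type u) where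
  Edge : ℕ → Type u
  src : ∀ {l : ℕ}, Edge l → V (l + 1)
  tgt : ∀ {l : ℕ}, Edge l → V l
  lab : ∀ {l : ℕ}, Edge l → S

/-- A labeled Bratteli diagram with downward edges over the alphabet `S`: an element of `Edge l`
is an edge of `E_{l,l+1}`, which goes from `V l` to `V (l+1)`. -/
structure DownwardDiagram (V : ℕ → Type u) (S : Type u) where
  Edge : ℕ → Type u
  src : ∀ {l : ℕ}, Edge l → V l
  tgt : ∀ {l : ℕ}, Edge l → V (l + 1)
  lab : ∀ {l : ℕ}, Edge l → S

/-- Reversal of all edges of an upward diagram (labels are kept). -/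
def UpwardDiagram.reverse {V : ℕ → Type u} {S : Type u} (L : UpwardDiagram V S) :
    DownwardDiagram V S where
  Edge := L.Edge
  src := fun e => L.tgt e
  tgt := fun e => L.src e
  lab := fun e => L.lab e

/-- Reversal of all edges of a downward diagram (labels are kept). -/
def DownwardDiagram.reverse {V : ℕ → Type u} {S : Type u} (L : DownwardDiagram V S) :
    UpwardDiagram V S where
  Edge := L.Edge
  src := fun e => L.tgt e
  tgt := fun e => L.src e
  lab := fun e => L.lab e

section Bisystem

variable {V : ℕ → Type u} {Sm Sp : Type u}

/-- The set `E_+^-(u, v)` of pairs `(e⁻, e⁺) ∈ E⁻_{l+1,l} × E⁺_{l+1,l+2}` with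
`t(e⁻) = u`, `s(e⁻) = s(e⁺)`, `t(e⁺) = v`. -/
def MinusPlusPath (Lm : UpwardDiagram V Sm) (Lp : DownwardDiagram V Sp) {l : ℕ}
    (a : V l) (b : V (l + 2)) : Type u :=
  {p : Lm.Edge l × Lp.Edge (l + 1) //
    Lm.tgt p.1 = a ∧ Lm.src p.1 = Lp.src p.2 ∧ Lp.tgt p.2 = b}

/-- The set `E_-^+(u, v)` of pairs `(f⁺, f⁻) ∈ E⁺_{l,l+1} × E⁻_{l+2,l+1}` with
`s(f⁺) = u`, `t(f⁺) = t(f⁻)`, `s(f⁻) = v`. -/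
def PlusMinusPath (Lm : UpwardDiagram V Sm) (Lp : DownwardDiagram V Sp) {l : ℕ}
    (a : V l) (b : V (l + 2)) : Type u :=
  {p : Lp.Edge l × Lm.Edge (l + 1) //
    Lp.src p.1 = a ∧ Lp.tgt p.1 = Lm.tgt p.2 ∧ Lm.src p.2 = b}

/-- The pair `(L⁻, L⁺)` of labeled Bratteli diagrams on the common vertex sets `V l` is a
`λ`-graph bisystem. -/
structure IsLambdaGraphBisystem (Lm : UpwardDiagram V Sm) (Lp : DownwardDiagram V Sp) :
    Prop where
  finite_vertex : ∀ l, Finite (V l)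
  finite_edge_minus : ∀ l, Finite (Lm.Edge l)
  finite_edge_plus : ∀ l, Finite (Lp.Edge l)
  exists_minus_tgt : ∀ l (v : V l), ∃ e : Lm.Edge l, Lm.tgt e = v
  exists_minus_src : ∀ l (v : V (l + 1)), ∃ e : Lm.Edge l, Lm.src e = v
  exists_plus_src : ∀ l (v : V l), ∃ e : Lp.Edge l, Lp.src e = v
  exists_plus_tgt : ∀ l (v : V (l + 1)), ∃ e : Lp.Edge l, Lp.tgt e = v
  right_resolving : ∀ l (e f : Lm.Edge l), Lm.src e = Lm.src f → Lm.lab e = Lm.lab f → e = f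
  left_resolving : ∀ l (e f : Lp.Edge l), Lp.tgt e = Lp.tgt f → Lp.lab e = Lp.lab f → e = f
  local_property : ∀ l (a : V l) (b : V (l + 2)),
    ∃ φ : MinusPlusPath Lm Lp a b ≃ PlusMinusPath Lm Lp a b,
      ∀ p, Lm.lab p.1.1 = Lm.lab (φ p).1.2 ∧ Lp.lab p.1.2 = Lp.lab (φ p).1.1

end Bisystem

/-! ### Deaconu–Renault groupoids and their `C*`-algebras -/

section Groupoid

variable {X : Type u}

/-- The Deaconu–Renault groupoid of `σ : X → X`: triples `(x, n, y)` with `n = k - l` and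
`σ^k x = σ^l y` for some natural numbers `k`, `l`. -/
def DRGroupoid (σ : X → X) : Type u :=
  {g : X × ℤ × X // ∃ k l : ℕ, g.2.1 = (k : ℤ) - (l : ℤ) ∧ σ^[k] g.1 = σ^[l] g.2.2}

namespace DRGroupoid

variable {σ : X → X}

/-- The range `x` of `(x, n, y)`. -/
def range (g : DRGroupoid σ) : X := g.1.1

/-- The integer `n` of `(x, n, y)`. -/
def degree (g : DRGroupoid σ) : ℤ := g.1.2.1

/-- The source `y` of `(x, n, y)`. -/
def source (g : DRGroupoid σ) : X := g.1.2.2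

/-- The product `(x, n, y)(y, m, z) = (x, n + m, z)`. -/
def mul (a b : DRGroupoid σ) (h : a.source = b.range) : DRGroupoid σ :=
  ⟨(a.range, a.degree + b.degree, b.source), by
    obtain ⟨⟨x, n, y⟩, k, l, hn, hk⟩ := a
    obtain ⟨⟨y', m, z⟩, k', l', hm, hk'⟩ := b
    simp only [source, range, degree] at *
    subst h
    refine ⟨k + k', l + l', by dsimp only at hn hm ⊢; rw [hn, hm]; push_cast; ring, ?_⟩
    dsimp only at hk hk' ⊢
    rw [Nat.add_comm k k', Function.iterate_add_apply, hk, ← Function.iterate_add_apply,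
      Nat.add_comm k' l, Function.iterate_add_apply, hk', ← Function.iterate_add_apply]⟩

/-- The inverse `(x, n, y)⁻¹ = (y, -n, x)`. -/
def inv (a : DRGroupoid σ) : DRGroupoid σ :=
  ⟨(a.source, -a.degree, a.range), by
    obtain ⟨⟨x, n, y⟩, k, l, hn, hk⟩ := a
    simp only [source, range, degree] at *
    exact ⟨l, k, by dsimp only at hn ⊢; rw [hn]; ring, hk.symm⟩⟩

/-- The topology with the basis of sets
`Z(U, k, l, W) = {(x, k - l, y) | x ∈ U, y ∈ W, σ^k x = σ^l y}`, `U` and `W` open in `X`. -/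
instance [TopologicalSpace X] : TopologicalSpace (DRGroupoid σ) :=
  TopologicalSpace.generateFrom
    {Z | ∃ (U W : Set X) (k l : ℕ), IsOpen U ∧ IsOpen W ∧
      Z = {g | g.range ∈ U ∧ g.source ∈ W ∧ g.degree = (k : ℤ) - (l : ℤ) ∧
        σ^[k] g.range = σ^[l] g.source}}

/-- The convolution product `(f * g)(s) = ∑_{s = t₁ t₂} f(t₁) g(t₂)`. -/
def conv (f g : DRGroupoid σ → ℂ) (s : DRGroupoid σ) : ℂ :=
  ∑ᶠ p : {p : DRGroupoid σ × DRGroupoid σ // ∃ h : p.1.source = p.2.range, mul p.1 p.2 h = s},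
    f p.1.1 * g p.1.2

/-- The involution `f^*(s) = conj (f(s⁻¹))`. -/
def involution (f : DRGroupoid σ → ℂ) (s : DRGroupoid σ) : ℂ :=
  (starRingEnd ℂ) (f s.inv)

end DRGroupoid

variable [TopologicalSpace X]

/-- A `*`-representation on a complex Hilbert space `H` of the convolution `*`-algebra of continuous
compactly supported functions on the groupoid. (When `σ` is a local homeomorphism of a locally
compact Hausdorff space, `C_c` is closed under convolution and involution, so `map_conv`
and `map_involution` speak about all `f`, `g`.) -/
structure GroupoidRep (σ : X → X) : Type (u + 1) where
  H : Type u
  [instNormed : NormedAddCommGroup H]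
  [instInner : InnerProductSpace ℂ H]
  [instComplete : CompleteSpace H]
  π : CompactlySupportedContinuousMap (DRGroupoid σ) ℂ →ₗ[ℂ] (H →L[ℂ] H)
  map_conv : ∀ f g h : CompactlySupportedContinuousMap (DRGroupoid σ) ℂ,
    (∀ s, h s = DRGroupoid.conv f g s) → π h = π f * π g
  map_involution : ∀ f h : CompactlySupportedContinuousMap (DRGroupoid σ) ℂ,
    (∀ s, h s = DRGroupoid.involution f s) → π h = star (π f)

attribute [instance] GroupoidRep.instNormed GroupoidRep.instInner GroupoidRep.instComplete

/-- The `C*`-algebra of all bounded families of operators, indexed by the representations. -/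
abbrev BoundedFamilies (σ : X → X) : Type (u + 1) :=
  lp (fun i : GroupoidRep σ => i.H →L[ℂ] i.H) ⊤

instance (σ : X → X) : NonUnitalCStarAlgebra (BoundedFamilies σ) where

/-- The family `a` is the image `(π(f))_π` of the continuous compactly supported function `f`
under the universal representation. -/
def IsUniversalImage {σ : X → X} (a : BoundedFamilies σ) (f : DRGroupoid σ → ℂ) : Prop :=
  ∃ F : CompactlySupportedContinuousMap (DRGroupoid σ) ℂ,
    (F : DRGroupoid σ → ℂ) = f ∧ ∀ i : GroupoidRep σ, (a : ∀ i, i.H →L[ℂ] i.H) i = i.π F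

/-- The closure of the image of the convolution algebra under the universal representation. -/
def groupoidCStarSubalgebra (σ : X → X) : NonUnitalStarSubalgebra ℂ (BoundedFamilies σ) :=
  (NonUnitalStarAlgebra.adjoin ℂ
    {a : BoundedFamilies σ | ∃ f, IsUniversalImage a f}).topologicalClosure

/-- The (full) groupoid `C*`-algebra. The norm of the image of `f ∈ C_c` is the supremum of
`‖π(f)‖` over all `*`-representations `π`. -/
def GroupoidCStar (σ : X → X) : Type (u + 1) :=
  groupoidCStarSubalgebra σ

instance (σ : X → X) : NonUnitalCStarAlgebra (GroupoidCStar σ) :=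
  haveI : IsClosed (groupoidCStarSubalgebra σ : Set (BoundedFamilies σ)) :=
    NonUnitalStarSubalgebra.isClosed_topologicalClosure _
  inferInstanceAs (NonUnitalCStarAlgebra (groupoidCStarSubalgebra σ))

/-- The element `a` of the groupoid `C*`-algebra is the characteristic function `χ_U ∈ C_c` of the
subset `U` of the groupoid. -/
def IsCharFun {σ : X → X} (a : GroupoidCStar σ) (U : Set (DRGroupoid σ)) : Prop :=
  IsUniversalImage (Subtype.val a : BoundedFamilies σ) (U.indicator fun _ => 1)

end Groupoid

/-! ### The shift dynamical systems of a `λ`-graph bisystem -/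

section Plus

variable {V : ℕ → Type u} {Sm Sp : Type u}

/-- The space `Ω_{L⁻}` of sequences `ω = (u_l, β_{-l})_{l ≥ 1}`; here `ω n = (u_{n+1}, β_{-(n+1)})`,
and `e n` is the edge of `E⁻_{n+1,n}` from `u_{n+1}` to `u_n` with label `β_{-(n+1)}`. -/
def OmegaMinus (Lm : UpwardDiagram V Sm) : Type u :=
  {ω : (n : ℕ) → V (n + 1) × Sm // ∃ e : (n : ℕ) → Lm.Edge n,
    ∀ n, Lm.src (e n) = (ω n).1 ∧ Lm.lab (e n) = (ω n).2 ∧ Lm.tgt (e (n + 1)) = (ω n).1}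

/-- The relative topology of the product of the discrete spaces `V (n+1) × Sm`. -/
instance (Lm : UpwardDiagram V Sm) : TopologicalSpace (OmegaMinus Lm) :=
  TopologicalSpace.induced Subtype.val
    (@Pi.topologicalSpace ℕ (fun n => V (n + 1) × Sm) fun _ => ⊥)

/-- The vertex `u_l(ω)`; `u_0(ω)` is the terminal vertex of the first edge. -/
def OmegaMinus.vertex {Lm : UpwardDiagram V Sm} (ω : OmegaMinus Lm) : (l : ℕ) → V l
  | 0 => Lm.tgt (ω.2.choose 0)
  | n + 1 => (ω.1 n).1

/-- The continuous graph `E⁺_{L⁻}`: the set of `(ω, α, ω')` with `ω = (u_l, β_{-l})`,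
`ω' = (u'_l, β_{-l+1})` and edges of `L⁺` labeled `α` from `u_l` to `u'_{l+1}`, `l ≥ 0`. -/
def GraphPlus (Lm : UpwardDiagram V Sm) (Lp : DownwardDiagram V Sp)
    (ω : OmegaMinus Lm) (α : Sp) (ω' : OmegaMinus Lm) : Prop :=
  (∀ n, (ω'.1 (n + 1)).2 = (ω.1 n).2) ∧
    ∀ l, ∃ e : Lp.Edge l, Lp.lab e = α ∧ Lp.src e = ω.vertex l ∧ Lp.tgt e = ω'.vertex (l + 1)

/-- The space `X⁺_{L⁻}` of sequences `(α_i, ω^i)_{i ≥ 1}`; here `x i = (α_{i+1}, ω^{i+1})`. -/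
def XPlus (Lm : UpwardDiagram V Sm) (Lp : DownwardDiagram V Sp) : Type u :=
  {x : ℕ → Sp × OmegaMinus Lm //
    (∀ i, GraphPlus Lm Lp (x i).2 (x (i + 1)).1 (x (i + 1)).2) ∧
      ∃ ω₀, GraphPlus Lm Lp ω₀ (x 0).1 (x 0).2}

/-- The relative topology of the product of the spaces `Sp × OmegaMinus Lm`, `Sp` discrete. -/
instance (Lm : UpwardDiagram V Sm) (Lp : DownwardDiagram V Sp) :
    TopologicalSpace (XPlus Lm Lp) :=
  letI : TopologicalSpace Sp := ⊥
  TopologicalSpace.induced (Subtype.val : _ → ℕ → Sp × OmegaMinus Lm) inferInstance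

/-- The shift `σ_{L⁻}` of `X⁺_{L⁻}`. -/
def shiftPlus (Lm : UpwardDiagram V Sm) (Lp : DownwardDiagram V Sp) (x : XPlus Lm Lp) :
    XPlus Lm Lp :=
  ⟨fun i => x.1 (i + 1), fun i => x.2.1 (i + 1), (x.1 0).2, x.2.1 0⟩

/-- The sequence `ω⁰(x)`, unique since `L⁺` is left-resolving. -/
def XPlus.initial {Lm : UpwardDiagram V Sm} {Lp : DownwardDiagram V Sp} (x : XPlus Lm Lp) :
    OmegaMinus Lm :=
  x.2.2.choose

/-- The `C*`-algebra `O⁺_{L⁻}` of the `λ`-graph bisystem `(L⁻, L⁺)`. -/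
abbrev OPlus (Lm : UpwardDiagram V Sm) (Lp : DownwardDiagram V Sp) : Type (u + 1) :=
  GroupoidCStar (shiftPlus Lm Lp)

/-- `a` is the generator `S_α = χ_{U(α)}` of `O⁺_{L⁻}`,
`U(α) = {(x, 1, z) | σ(x) = z, λ_1(x) = α}`. -/
def IsGeneratorS (Lm : UpwardDiagram V Sm) (Lp : DownwardDiagram V Sp) (α : Sp)
    (a : OPlus Lm Lp) : Prop :=
  IsCharFun a {g | g.degree = 1 ∧ shiftPlus Lm Lp g.range = g.source ∧ (g.range.1 0).1 = α}

/-- `a` is the projection `E_v^{l-}(ξ) = χ_{U(v;ξ)}` of `O⁺_{L⁻}`, where `U(v;ξ)` is the set of the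
units `(x, 0, x)` such that `ω⁰(x) = (u_l, β_{-l})` has `u_l = v` and
`(β_{-l}, …, β_{-1}) = (ξ_1, …, ξ_l)`. -/
def IsProjectionMinus (Lm : UpwardDiagram V Sm) (Lp : DownwardDiagram V Sp) {l : ℕ} (v : V l)
    (ξ : Fin l → Sm) (a : OPlus Lm Lp) : Prop :=
  IsCharFun a {g | g.degree = 0 ∧ g.range = g.source ∧ g.range.initial.vertex l = v ∧
    ∀ k : Fin l, (g.range.initial.1 (Fin.rev k : Fin l)).2 = ξ k}

end Plus

section Minus

variable {V : ℕ → Type u} {Sm Sp : Type u}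

/-- The space `Ω_{L⁺}` of sequences `ω = (α_l, u_l)_{l ≥ 1}`; here `ω n = (α_{n+1}, u_{n+1})`,
and `e n` is the edge of `E⁺_{n,n+1}` from `u_n` to `u_{n+1}` with label `α_{n+1}`. -/
def OmegaPlus (Lp : DownwardDiagram V Sp) : Type u :=
  {ω : (n : ℕ) → Sp × V (n + 1) // ∃ e : (n : ℕ) → Lp.Edge n,
    ∀ n, Lp.lab (e n) = (ω n).1 ∧ Lp.tgt (e n) = (ω n).2 ∧ Lp.src (e (n + 1)) = (ω n).2}

/-- The relative topology of the product of the discrete spaces `Sp × V (n+1)`. -/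
instance (Lp : DownwardDiagram V Sp) : TopologicalSpace (OmegaPlus Lp) :=
  TopologicalSpace.induced Subtype.val
    (@Pi.topologicalSpace ℕ (fun n => Sp × V (n + 1)) fun _ => ⊥)

/-- The vertex `u_l(ω)`; `u_0(ω)` is the source vertex of the first edge. -/
def OmegaPlus.vertex {Lp : DownwardDiagram V Sp} (ω : OmegaPlus Lp) : (l : ℕ) → V l
  | 0 => Lp.src (ω.2.choose 0)
  | n + 1 => (ω.1 n).2

/-- The continuous graph `E⁻_{L⁺}`: the set of `(ω, β, ω')` with `ω = (α_l, u_l)`,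
`ω' = (α_{l-1}, u'_l)` and edges of `L⁻` labeled `β` from `u'_{l+1}` to `u_l`, `l ≥ 0`. -/
def GraphMinus (Lm : UpwardDiagram V Sm) (Lp : DownwardDiagram V Sp)
    (ω : OmegaPlus Lp) (β : Sm) (ω' : OmegaPlus Lp) : Prop :=
  (∀ n, (ω'.1 (n + 1)).1 = (ω.1 n).1) ∧
    ∀ l, ∃ e : Lm.Edge l, Lm.lab e = β ∧ Lm.tgt e = ω.vertex l ∧ Lm.src e = ω'.vertex (l + 1)

/-- The space `X⁻_{L⁺}` of sequences `(β_i, ω^i)_{i ≥ 1}`; here `x i = (β_{i+1}, ω^{i+1})`. -/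
def XMinus (Lm : UpwardDiagram V Sm) (Lp : DownwardDiagram V Sp) : Type u :=
  {x : ℕ → Sm × OmegaPlus Lp //
    (∀ i, GraphMinus Lm Lp (x i).2 (x (i + 1)).1 (x (i + 1)).2) ∧
      ∃ ω₀, GraphMinus Lm Lp ω₀ (x 0).1 (x 0).2}

/-- The relative topology of the product of the spaces `Sm × OmegaPlus Lp`, `Sm` discrete. -/
instance (Lm : UpwardDiagram V Sm) (Lp : DownwardDiagram V Sp) :
    TopologicalSpace (XMinus Lm Lp) :=
  letI : TopologicalSpace Sm := ⊥
  TopologicalSpace.induced (Subtype.val : _ → ℕ → Sm × OmegaPlus Lp) inferInstance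

/-- The shift `σ_{L⁺}` of `X⁻_{L⁺}`. -/
def shiftMinus (Lm : UpwardDiagram V Sm) (Lp : DownwardDiagram V Sp) (x : XMinus Lm Lp) :
    XMinus Lm Lp :=
  ⟨fun i => x.1 (i + 1), fun i => x.2.1 (i + 1), (x.1 0).2, x.2.1 0⟩

/-- The sequence `ω⁰(x)`, unique since `L⁻` is right-resolving. -/
def XMinus.initial {Lm : UpwardDiagram V Sm} {Lp : DownwardDiagram V Sp} (x : XMinus Lm Lp) :
    OmegaPlus Lp :=
  x.2.2.choose

/-- The `C*`-algebra `O⁻_{L⁺}` of the `λ`-graph bisystem `(L⁻, L⁺)`. -/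
abbrev OMinus (Lm : UpwardDiagram V Sm) (Lp : DownwardDiagram V Sp) : Type (u + 1) :=
  GroupoidCStar (shiftMinus Lm Lp)

/-- `a` is the generator `T_β = χ_{U(β)}` of `O⁻_{L⁺}`,
`U(β) = {(x, 1, z) | σ(x) = z, λ_1(x) = β}`. -/
def IsGeneratorT (Lm : UpwardDiagram V Sm) (Lp : DownwardDiagram V Sp) (β : Sm)
    (a : OMinus Lm Lp) : Prop :=
  IsCharFun a {g | g.degree = 1 ∧ shiftMinus Lm Lp g.range = g.source ∧ (g.range.1 0).1 = β}

/-- `a` is the projection `E_v^{l+}(η) = χ_{U(v;η)}` of `O⁻_{L⁺}`, where `U(v;η)` is the set of the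
units `(x, 0, x)` such that `ω⁰(x) = (α_l, u_l)` has `u_l = v` and
`(α_1, …, α_l) = (η_1, …, η_l)`. -/
def IsProjectionPlus (Lm : UpwardDiagram V Sm) (Lp : DownwardDiagram V Sp) {l : ℕ} (v : V l)
    (η : Fin l → Sp) (a : OMinus Lm Lp) : Prop :=
  IsCharFun a {g | g.degree = 0 ∧ g.range = g.source ∧ g.range.initial.vertex l = v ∧
    ∀ k : Fin l, (g.range.initial.1 k).1 = η k}

end Minus

end

/-! ### Functoriality of the Deaconu–Renault groupoid `C*`-algebra under conjugacy -/

namespace DRGroupoid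

variable {X Y : Type u} {σ : X → X} {τ : Y → Y}

/-! A path of $\mathfrak L^-$ and its reversal in $\mathfrak L^{-t}$ carry the same vertices and
labels, so swapping the entries of each pair (label, vertex) is a homeomorphism of the path spaces
$\Omega$. It matches the two continuous graphs, hence yields a conjugacy of the shifts
(`XMinus.reverseHomeomorph`). A conjugacy induces an isomorphism of the Deaconu–Renault groupoids
and of their convolution $*$-algebras; composition with it is a bijection between the
representations, so the universal completions are isomorphic (`GroupoidCStar.congr`) and
characteristic functions go to characteristic functions of preimages (`IsCharFun.congr`). Since
reversing twice changes nothing, $\Psi$ is the inverse of the map $\Phi$ of the reversed bisystem.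

It must also be shown that the generators exist: their characteristic functions have to lie in $C_c$
and be bounded uniformly over all representations. Finiteness and the resolving conditions make the
shift space compact Hausdorff, the relevant sets clopen, and the shift injective on each set of
fixed first label. The characteristic functions then become projections or partial isometries, of
norm at most 1 (`exists_isCharFun_unitSet`, `exists_isCharFun_shiftSet`). The resolving conditions
also make $u_0$ and $\omega^0$, which are defined by choice, unique and so compatible with reversal.
-/

theorem ext' {a b : DRGroupoid σ} (hr : a.range = b.range) (hd : a.degree = b.degree)
    (hs : a.source = b.source) : a = b :=
  Subtype.ext (Prod.ext hr (Prod.ext hd hs))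

/-- The map of groupoids induced by a map which intertwines the transformations. -/
def map (f : X → Y) (hf : ∀ x, f (σ x) = τ (f x)) (g : DRGroupoid σ) : DRGroupoid τ :=
  ⟨(f g.range, g.degree, f g.source), by
    obtain ⟨k, l, hn, hk⟩ := g.2
    refine ⟨k, l, hn, ?_⟩
    have h : ∀ n x, f (σ^[n] x) = τ^[n] (f x) := fun n x =>
      (Function.Semiconj.iterate_right (f := f) (ga := σ) (gb := τ) hf n) x
    exact (h k _).symm.trans ((congrArg f hk).trans (h l _))⟩

theorem intertwines_symm (f : X ≃ Y) (hf : ∀ x, f (σ x) = τ (f x)) (y : Y) :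
    f.symm (τ y) = σ (f.symm y) := by
  rw [Equiv.symm_apply_eq, hf, Equiv.apply_symm_apply]

section Topology

variable [TopologicalSpace X] [TopologicalSpace Y]

theorem isOpen_basic {U W : Set X} (hU : IsOpen U) (hW : IsOpen W) (k l : ℕ) :
    IsOpen {g : DRGroupoid σ | g.range ∈ U ∧ g.source ∈ W ∧ g.degree = (k : ℤ) - (l : ℤ) ∧
        σ^[k] g.range = σ^[l] g.source} :=
  TopologicalSpace.isOpen_generateFrom_of_mem ⟨U, W, k, l, hU, hW, rfl⟩

theorem continuous_map {f : X ≃ Y} (hc : Continuous f) (hf : ∀ x, f (σ x) = τ (f x)) :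
    Continuous (map (σ := σ) (τ := τ) f hf) := by
  refine continuous_generateFrom_iff.2 ?_
  rintro _ ⟨U, W, k, l, hU, hW, rfl⟩
  convert! isOpen_basic (σ := σ) (hU.preimage hc) (hW.preimage hc) k l using 1
  ext g
  have h : ∀ n x, f (σ^[n] x) = τ^[n] (f x) := fun n x =>
    (Function.Semiconj.iterate_right (f := f) (ga := σ) (gb := τ) hf n) x
  change (f g.range ∈ U ∧ f g.source ∈ W ∧ g.degree = _ ∧ τ^[k] (f g.range) = τ^[l] (f g.source)) ↔
    (f g.range ∈ U ∧ f g.source ∈ W ∧ g.degree = _ ∧ σ^[k] g.range = σ^[l] g.source)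
  -- Injectivity is what lets the tail condition for `τ` be read back as the one for `σ`.
  rw [← h, ← h, f.injective.eq_iff]

/-- The homeomorphism of groupoids induced by a topological conjugacy. -/
def congr (f : X ≃ₜ Y) (hf : ∀ x, f (σ x) = τ (f x)) : DRGroupoid σ ≃ₜ DRGroupoid τ where
  toFun := map f hf
  invFun := map f.symm (intertwines_symm f.toEquiv hf)
  left_inv _ := ext' (f.symm_apply_apply _) rfl (f.symm_apply_apply _)
  right_inv _ := ext' (f.apply_symm_apply _) rfl (f.apply_symm_apply _)
  continuous_toFun := continuous_map (f := f.toEquiv) f.continuous hf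
  continuous_invFun := continuous_map (f := f.symm.toEquiv) f.symm.continuous _

/-- The groupoid isomorphism carries the factorizations of `s` bijectively onto those of its image,
so the two sums agree after reindexing. -/
theorem conv_comp_congr (f : X ≃ₜ Y) (hf : ∀ x, f (σ x) = τ (f x)) (p q : DRGroupoid τ → ℂ)
    (s : DRGroupoid σ) : conv (p ∘ congr f hf) (q ∘ congr f hf) s = conv p q (congr f hf s) := by
  have key : ∀ a b : DRGroupoid σ, (∃ h : a.source = b.range, mul a b h = s) ↔
      ∃ h : (congr f hf a).source = (congr f hf b).range,
        mul (congr f hf a) (congr f hf b) h = congr f hf s := by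
    intro a b
    constructor
    · rintro ⟨h, rfl⟩
      exact ⟨congrArg f h, rfl⟩
    · rintro ⟨h, e⟩
      have h' : a.source = b.range := f.injective h
      exact ⟨h', (congr f hf).injective (Eq.trans rfl e)⟩
  exact finsum_comp_equiv (f := fun p' => p p'.1.1 * q p'.1.2)
    (((congr f hf).toEquiv.prodCongr (congr f hf).toEquiv).subtypeEquiv fun p => key p.1 p.2)

end Topology

end DRGroupoid

/-! ### Transport of representations and of completions along a conjugacy -/

section Conjugacy

variable {X Y : Type u} {σ : X → X} {τ : Y → Y} [TopologicalSpace X] [TopologicalSpace Y]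

/-- Transport of functions in `C_c` along a topological conjugacy. -/
noncomputable def compactlySupportedComp (f : X ≃ₜ Y) (hf : ∀ x, f (σ x) = τ (f x)) :
    CompactlySupportedContinuousMap (DRGroupoid τ) ℂ →ₗ[ℂ]
      CompactlySupportedContinuousMap (DRGroupoid σ) ℂ :=
  CompactlySupportedContinuousMap.compLinearMap (R := ℂ)
    { (DRGroupoid.congr f hf : C(DRGroupoid σ, DRGroupoid τ)) with
      cocompact_tendsto' := (DRGroupoid.congr f hf).isClosedEmbedding.tendsto_cocompact }

/-- Transport of a representation along a topological conjugacy. -/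
noncomputable def GroupoidRep.pull (f : X ≃ₜ Y) (hf : ∀ x, f (σ x) = τ (f x)) (i : GroupoidRep σ) :
    GroupoidRep τ where
  H := i.H
  π := i.π.comp (compactlySupportedComp f hf)
  map_conv p q _ e := i.map_conv _ _ _ fun s =>
    (e _).trans (DRGroupoid.conv_comp_congr f hf p q s).symm
  map_involution _ _ e := i.map_involution _ _ fun _ => e _

theorem GroupoidRep.pull_pull (f : X ≃ₜ Y) (hf : ∀ x, f (σ x) = τ (f x)) (g : Y ≃ₜ X)
    (hg : ∀ y, g (τ y) = σ (g y)) (h : ∀ x, g (f x) = x) (i : GroupoidRep σ) :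
    (i.pull f hf).pull g hg = i := by
  obtain ⟨H, π, h₁, h₂⟩ := i
  -- The Hilbert space is literally unchanged, so only the linear map has to be compared; the two
  -- remaining fields are proofs.
  have key : ∀ π' : CompactlySupportedContinuousMap (DRGroupoid σ) ℂ →ₗ[ℂ] (H →L[ℂ] H), π' = π →
      ∀ h₁' h₂', (⟨H, π', h₁', h₂'⟩ : GroupoidRep σ) = ⟨H, π, h₁, h₂⟩ := by
    rintro _ rfl _ _
    rfl
  refine key ((π.comp (compactlySupportedComp f hf)).comp (compactlySupportedComp g hg))
    (LinearMap.ext fun p => congrArg π ?_) _ _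
  exact CompactlySupportedContinuousMap.ext fun s => congrArg p (DRGroupoid.ext' (h _) rfl (h _))

/-- The homomorphism of algebras of bounded families induced by a topological conjugacy. -/
noncomputable def BoundedFamilies.transport (f : X ≃ₜ Y) (hf : ∀ x, f (σ x) = τ (f x)) :
    BoundedFamilies τ →⋆ₙₐ[ℂ] BoundedFamilies σ where
  toFun a := ⟨fun i => a (i.pull f hf), memℓp_infty <|
    (memℓp_infty_iff.1 a.2).mono <| by rintro _ ⟨i, rfl⟩; exact ⟨i.pull f hf, rfl⟩⟩
  map_smul' _ _ := rfl
  map_zero' := rfl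
  map_add' _ _ := rfl
  map_mul' _ _ := rfl
  map_star' _ := rfl

theorem BoundedFamilies.transport_transport (f : X ≃ₜ Y) (hf : ∀ x, f (σ x) = τ (f x)) (g : Y ≃ₜ X)
    (hg : ∀ y, g (τ y) = σ (g y)) (h : ∀ x, g (f x) = x) (a : BoundedFamilies σ) :
    BoundedFamilies.transport f hf (BoundedFamilies.transport g hg a) = a := by
  refine lp.ext (funext fun i => ?_)
  -- The operators `a j` and `a i` act on spaces depending on the index, so the equality of
  -- representations is used heterogeneously.
  have key : ∀ j : GroupoidRep σ, j = i → HEq (a j) (a i) := by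
    rintro j rfl
    rfl
  exact eq_of_heq (key _ (i.pull_pull f hf g hg h))

theorem IsUniversalImage.transport (f : X ≃ₜ Y) (hf : ∀ x, f (σ x) = τ (f x))
    {a : BoundedFamilies τ} {p : DRGroupoid τ → ℂ} (h : IsUniversalImage a p) :
    IsUniversalImage (BoundedFamilies.transport f hf a) (p ∘ DRGroupoid.congr f hf) := by
  obtain ⟨F, rfl, hF⟩ := h
  exact ⟨compactlySupportedComp f hf F, rfl, fun i => hF _⟩

/-- Transport sends images of $C_c$ to images of $C_c$. It is also contractive, its components being
among those of `a`, and so it respects the closures. -/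
theorem groupoidCStarSubalgebra.transport_mem (f : X ≃ₜ Y) (hf : ∀ x, f (σ x) = τ (f x))
    {a : BoundedFamilies τ} (ha : a ∈ groupoidCStarSubalgebra τ) :
    BoundedFamilies.transport f hf a ∈ groupoidCStarSubalgebra σ := by
  have hc : Continuous (BoundedFamilies.transport f hf) := by
    refine AddMonoidHomClass.continuous_of_bound (BoundedFamilies.transport f hf) 1 fun a => ?_
    rw [one_mul]
    exact lp.norm_le_of_forall_le (norm_nonneg a) fun i => lp.norm_apply_le_norm (by simp) a _
  suffices h : groupoidCStarSubalgebra τ ≤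
      (groupoidCStarSubalgebra σ).comap (BoundedFamilies.transport f hf) from h ha
  refine NonUnitalStarSubalgebra.topologicalClosure_minimal _ ?_
    ((NonUnitalStarSubalgebra.isClosed_topologicalClosure _).preimage hc)
  refine NonUnitalStarAlgebra.adjoin_le ?_
  rintro b ⟨p, hp⟩
  exact NonUnitalStarSubalgebra.le_topologicalClosure _
    (NonUnitalStarAlgebra.subset_adjoin ℂ _ ⟨_, hp.transport f hf⟩)

/-- The isomorphism of groupoid `C*`-algebras induced by a topological conjugacy. -/
noncomputable def GroupoidCStar.congr (f : X ≃ₜ Y) (hf : ∀ x, f (σ x) = τ (f x)) :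
    GroupoidCStar τ ≃⋆ₐ[ℂ] GroupoidCStar σ where
  toFun a := ⟨_, groupoidCStarSubalgebra.transport_mem f hf a.2⟩
  invFun a := ⟨_, groupoidCStarSubalgebra.transport_mem f.symm
    (DRGroupoid.intertwines_symm f.toEquiv hf) a.2⟩
  left_inv a := Subtype.ext
    (BoundedFamilies.transport_transport f.symm _ f hf f.apply_symm_apply a.1)
  right_inv a := Subtype.ext
    (BoundedFamilies.transport_transport f hf f.symm _ f.symm_apply_apply a.1)
  map_mul' _ _ := rfl
  map_add' _ _ := rfl
  map_star' _ := rfl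
  map_smul' _ _ := rfl

theorem IsCharFun.congr (f : X ≃ₜ Y) (hf : ∀ x, f (σ x) = τ (f x)) {a : GroupoidCStar τ}
    {U : Set (DRGroupoid τ)} (h : IsCharFun a U) :
    IsCharFun (GroupoidCStar.congr f hf a) (DRGroupoid.congr f hf ⁻¹' U) :=
  IsUniversalImage.transport f hf h

end Conjugacy

/-! ### Characteristic functions of compact open bisections -/

namespace DRGroupoid

variable {X : Type u} {σ : X → X}

/-- If $Z = UW$ with unique factorization, exactly one term of the convolution sum is nonzero at a
point of `Z`, and none elsewhere. -/
theorem conv_indicator {U W Z : Set (DRGroupoid σ)}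
    (hmul : ∀ a ∈ U, ∀ b ∈ W, ∀ h : a.source = b.range, mul a b h ∈ Z)
    (huniq : ∀ s ∈ Z, ∃ a ∈ U, ∃ b ∈ W, (∃ h : a.source = b.range, mul a b h = s) ∧
      ∀ a' ∈ U, ∀ b' ∈ W, ∀ h : a'.source = b'.range, mul a' b' h = s → a' = a ∧ b' = b)
    (s : DRGroupoid σ) :
    Z.indicator (fun _ => (1 : ℂ)) s =
      conv (U.indicator fun _ => 1) (W.indicator fun _ => 1) s := by
  by_cases hs : s ∈ Z
  · obtain ⟨a, ha, b, hb, hab, hu⟩ := huniq s hs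
    rw [conv, finsum_eq_single _ ⟨(a, b), hab⟩, Set.indicator_of_mem hs, Set.indicator_of_mem ha,
      Set.indicator_of_mem hb, mul_one]
    rintro ⟨⟨a', b'⟩, h, e⟩ hne
    by_contra h0
    have ha' : a' ∈ U := Set.mem_of_indicator_ne_zero (left_ne_zero_of_mul h0)
    have hb' : b' ∈ W := Set.mem_of_indicator_ne_zero (right_ne_zero_of_mul h0)
    obtain ⟨rfl, rfl⟩ := hu a' ha' b' hb' h e
    exact hne rfl
  · rw [Set.indicator_of_notMem hs, conv, finsum_eq_zero_of_forall_eq_zero]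
    rintro ⟨⟨a, b⟩, h, e⟩
    by_contra h0
    refine hs (e ▸ hmul a ?_ b ?_ h)
    · exact Set.mem_of_indicator_ne_zero (left_ne_zero_of_mul h0)
    · exact Set.mem_of_indicator_ne_zero (right_ne_zero_of_mul h0)

theorem involution_indicator {U W : Set (DRGroupoid σ)} (h : ∀ s, s ∈ W ↔ s.inv ∈ U)
    (s : DRGroupoid σ) :
    W.indicator (fun _ => (1 : ℂ)) s = involution (U.indicator fun _ => 1) s := by
  unfold involution
  by_cases hs : s ∈ W
  · rw [Set.indicator_of_mem hs, Set.indicator_of_mem ((h s).1 hs), map_one]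
  · rw [Set.indicator_of_notMem hs, Set.indicator_of_notMem (mt (h s).2 hs), map_zero]

/-- The set of units `(x, 0, x)` with `x ∈ D`. -/
def unitSet (σ : X → X) (D : Set X) : Set (DRGroupoid σ) :=
  {g | g.degree = 0 ∧ g.range = g.source ∧ g.range ∈ D}

/-- The set of elements `(x, 1, σ x)` with `x ∈ D`. -/
def shiftSet (σ : X → X) (D : Set X) : Set (DRGroupoid σ) :=
  {g | g.degree = 1 ∧ σ g.range = g.source ∧ g.range ∈ D}

/-- The set of elements `(σ x, -1, x)` with `x ∈ D`. -/
def coshiftSet (σ : X → X) (D : Set X) : Set (DRGroupoid σ) :=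
  {g | g.degree = -1 ∧ g.range = σ g.source ∧ g.source ∈ D}

/-- The unit `(x, 0, x)`. -/
def unit (σ : X → X) (x : X) : DRGroupoid σ := ⟨(x, 0, x), 0, 0, rfl, rfl⟩

/-- The element `(x, 1, σ x)`. -/
def shift (σ : X → X) (x : X) : DRGroupoid σ := ⟨(x, 1, σ x), 1, 0, rfl, rfl⟩

theorem unitSet_eq_image (D : Set X) : unitSet σ D = unit σ '' D := by
  ext g
  constructor
  · rintro ⟨hd, hr, hD⟩
    exact ⟨g.range, hD, ext' rfl hd.symm hr⟩
  · rintro ⟨x, hx, rfl⟩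
    exact ⟨rfl, rfl, hx⟩

theorem shiftSet_eq_image (D : Set X) : shiftSet σ D = shift σ '' D := by
  ext g
  constructor
  · rintro ⟨hd, hr, hD⟩
    exact ⟨g.range, hD, ext' rfl hd.symm hr⟩
  · rintro ⟨x, hx, rfl⟩
    exact ⟨rfl, rfl, hx⟩

theorem coshiftSet_eq_image (D : Set X) : coshiftSet σ D = inv '' shiftSet σ D := by
  ext g
  constructor
  · rintro ⟨hd, hr, hD⟩
    refine ⟨g.inv, ⟨?_, hr.symm, hD⟩, ext' rfl (neg_neg g.degree) rfl⟩
    change -g.degree = 1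
    rw [hd, neg_neg]
  · rintro ⟨s, ⟨hd, hr, hD⟩, rfl⟩
    exact ⟨congrArg Neg.neg hd, hr.symm, hD⟩

theorem conv_indicator_unitSet (D : Set X) (s : DRGroupoid σ) :
    (unitSet σ D).indicator (fun _ => (1 : ℂ)) s =
      conv ((unitSet σ D).indicator fun _ => 1) ((unitSet σ D).indicator fun _ => 1) s := by
  refine conv_indicator ?_ ?_ s
  · rintro a ⟨had, har, haD⟩ b ⟨hbd, hbr, hbD⟩ h
    refine ⟨?_, har.trans (h.trans hbr), haD⟩
    change a.degree + b.degree = 0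
    rw [had, hbd, add_zero]
  · rintro s ⟨hd, hr, hD⟩
    refine ⟨s, ⟨hd, hr, hD⟩, s, ⟨hd, hr, hD⟩, ⟨hr.symm, ext' rfl ?_ rfl⟩, ?_⟩
    · change s.degree + s.degree = s.degree
      rw [hd, add_zero]
    · rintro a ⟨had, har, haD⟩ b ⟨hbd, hbr, hbD⟩ h rfl
      exact ⟨ext' rfl (had.trans hd.symm) (h.trans hbr),
        ext' (h.symm.trans har.symm) (hbd.trans hd.symm) rfl⟩

/-- This is $\chi_U * \chi_U^* = \chi_{UU^{-1}}$ for $U = \{(x,1,\sigma x) : x \in D\}$. Injectivity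
on `D` forces $UU^{-1}$ to consist of units. -/
theorem conv_indicator_shiftSet {D : Set X} (hinj : Set.InjOn σ D) (s : DRGroupoid σ) :
    (unitSet σ D).indicator (fun _ => (1 : ℂ)) s =
      conv ((shiftSet σ D).indicator fun _ => 1) ((coshiftSet σ D).indicator fun _ => 1) s := by
  refine conv_indicator ?_ ?_ s
  · rintro a ⟨had, har, haD⟩ b ⟨hbd, hbr, hbD⟩ h
    refine ⟨?_, hinj haD hbD (har.trans (h.trans hbr)), haD⟩
    change a.degree + b.degree = 0
    rw [had, hbd, add_neg_cancel]
  · rintro s ⟨hd, hr, hD⟩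
    refine ⟨shift σ s.range, ⟨rfl, rfl, hD⟩, (shift σ s.range).inv, ⟨rfl, rfl, hD⟩,
      ⟨rfl, ext' rfl ?_ hr⟩, ?_⟩
    · exact hd.symm
    · rintro a ⟨had, har, haD⟩ b ⟨hbd, hbr, hbD⟩ h rfl
      refine ⟨ext' rfl had har.symm, ext' ?_ hbd hr.symm⟩
      exact h.symm.trans har.symm

variable [TopologicalSpace X]

theorem continuous_range : Continuous (range : DRGroupoid σ → X) := by
  refine continuous_def.2 fun U hU => isOpen_iff_forall_mem_open.2 fun g hg => ?_
  obtain ⟨k, l, hn, hk⟩ := g.2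
  exact ⟨_, fun _ h => h.1, isOpen_basic hU isOpen_univ k l, hg, trivial, hn, hk⟩

theorem continuous_source : Continuous (source : DRGroupoid σ → X) := by
  refine continuous_def.2 fun U hU => isOpen_iff_forall_mem_open.2 fun g hg => ?_
  obtain ⟨k, l, hn, hk⟩ := g.2
  exact ⟨_, fun _ h => h.2.1, isOpen_basic isOpen_univ hU k l, trivial, hg, hn, hk⟩

theorem continuous_degree : Continuous (degree : DRGroupoid σ → ℤ) := by
  refine continuous_def.2 fun U _ => isOpen_iff_forall_mem_open.2 fun g hg => ?_
  obtain ⟨k, l, hn, hk⟩ := g.2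
  refine ⟨_, fun s h => ?_, isOpen_basic isOpen_univ isOpen_univ k l, trivial, trivial, hn, hk⟩
  -- The degree is constant on each basic open set.
  rw [Set.mem_preimage, show s.degree = g.degree from h.2.2.1.trans hn.symm]
  exact hg

instance [T2Space X] : T2Space (DRGroupoid σ) :=
  T2Space.of_injective_continuous (f := fun g : DRGroupoid σ => (g.range, g.degree, g.source))
    (fun _ _ h => Subtype.ext h)
    (continuous_range.prodMk (continuous_degree.prodMk continuous_source))

theorem continuous_unit : Continuous (unit σ) := by
  refine continuous_generateFrom_iff.2 ?_
  rintro _ ⟨U, W, k, l, hU, hW, rfl⟩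
  by_cases h : k = l
  -- On units the tail condition is automatic when `k = l`, and the degree condition fails
  -- otherwise.
  · subst h
    convert! hU.inter hW using 1
    ext x
    exact ⟨fun h => ⟨h.1, h.2.1⟩, fun h => ⟨h.1, h.2, (sub_self _).symm, rfl⟩⟩
  · convert! isOpen_empty using 1
    refine Set.eq_empty_of_forall_notMem fun x hx => h ?_
    have := hx.2.2.1
    change (0 : ℤ) = k - l at this
    omega

theorem continuous_shift (hσ : Continuous σ) : Continuous (shift σ) := by
  refine continuous_generateFrom_iff.2 ?_
  rintro _ ⟨U, W, k, l, hU, hW, rfl⟩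
  by_cases h : k = l + 1
  · subst h
    convert! hU.inter (hW.preimage hσ) using 1
    ext x
    refine ⟨fun h => ⟨h.1, h.2.1⟩, fun h => ⟨h.1, h.2, ?_, rfl⟩⟩
    change (1 : ℤ) = _
    push_cast
    ring
  · convert! isOpen_empty using 1
    refine Set.eq_empty_of_forall_notMem fun x hx => h ?_
    have := hx.2.2.1
    change (1 : ℤ) = k - l at this
    omega

theorem continuous_inv : Continuous (inv : DRGroupoid σ → DRGroupoid σ) := by
  refine continuous_generateFrom_iff.2 ?_
  rintro _ ⟨U, W, k, l, hU, hW, rfl⟩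
  convert! isOpen_basic (σ := σ) hW hU l k using 1
  ext g
  change (g.source ∈ U ∧ g.range ∈ W ∧ -g.degree = _ ∧ σ^[k] g.source = σ^[l] g.range) ↔ _
  constructor
  · rintro ⟨h₁, h₂, h₃, h₄⟩
    exact ⟨h₂, h₁, by omega, h₄.symm⟩
  · rintro ⟨h₁, h₂, h₃, h₄⟩
    exact ⟨h₂, h₁, by omega, h₄.symm⟩

theorem isOpen_unitSet {D : Set X} (hD : IsOpen D) : IsOpen (unitSet σ D) := by
  convert! isOpen_basic (σ := σ) hD isOpen_univ 0 0 using 1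
  ext g
  exact ⟨fun h => ⟨h.2.2, trivial, h.1, h.2.1⟩, fun h => ⟨h.2.2.1, h.2.2.2, h.1⟩⟩

theorem isOpen_shiftSet {D : Set X} (hD : IsOpen D) : IsOpen (shiftSet σ D) := by
  convert! isOpen_basic (σ := σ) hD isOpen_univ 1 0 using 1
  ext g
  exact ⟨fun h => ⟨h.2.2, trivial, h.1, h.2.1⟩, fun h => ⟨h.2.2.1, h.2.2.2, h.1⟩⟩

theorem isOpen_coshiftSet {D : Set X} (hD : IsOpen D) : IsOpen (coshiftSet σ D) := by
  convert! isOpen_basic (σ := σ) isOpen_univ hD 0 1 using 1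
  ext g
  exact ⟨fun h => ⟨trivial, h.2.2, h.1, h.2.1⟩, fun h => ⟨h.2.2.1, h.2.2.2, h.2.1⟩⟩

end DRGroupoid

/-! ### Existence of characteristic functions in the completion -/

section CharFun

variable {X : Type u} [TopologicalSpace X] {σ : X → X}

theorem exists_compactlySupported_indicator {G : Type*} [TopologicalSpace G] [T2Space G]
    {U : Set G} (hc : IsCompact U) (ho : IsOpen U) :
    ∃ F : CompactlySupportedContinuousMap G ℂ, (F : G → ℂ) = U.indicator fun _ => 1 :=
  ⟨⟨⟨U.indicator fun _ => 1, IsClopen.continuous_indicator ⟨hc.isClosed, ho⟩ continuous_const⟩,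
    HasCompactSupport.intro hc fun _ h => Set.indicator_of_notMem h fun _ => (1 : ℂ)⟩, rfl⟩

/-- Representations are not assumed bounded in any norm on $C_c$, so a bound uniform in `i` is
needed for the family to be an element of the completion. -/
theorem exists_isCharFun {U : Set (DRGroupoid σ)}
    {F : CompactlySupportedContinuousMap (DRGroupoid σ) ℂ}
    (hF : (F : DRGroupoid σ → ℂ) = U.indicator fun _ => 1) {C : ℝ}
    (hC : ∀ i : GroupoidRep σ, ‖i.π F‖ ≤ C) : ∃ a : GroupoidCStar σ, IsCharFun a U := by
  let b : BoundedFamilies σ :=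
    ⟨fun i => i.π F, memℓp_infty ⟨C, by rintro _ ⟨i, rfl⟩; exact hC i⟩⟩
  have hb : IsUniversalImage b (U.indicator fun _ => 1) := ⟨F, hF, fun _ => rfl⟩
  exact ⟨⟨b, NonUnitalStarSubalgebra.le_topologicalClosure _
    (NonUnitalStarAlgebra.subset_adjoin ℂ _ ⟨_, hb⟩)⟩, hb⟩

/-- The image is a self-adjoint idempotent, so by the $C^*$-identity its norm equals its own square.
-/
theorem GroupoidRep.norm_indicator_unitSet_le {D : Set X}
    {F : CompactlySupportedContinuousMap (DRGroupoid σ) ℂ}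
    (hF : (F : DRGroupoid σ → ℂ) = (DRGroupoid.unitSet σ D).indicator fun _ => 1)
    (i : GroupoidRep σ) : ‖i.π F‖ ≤ 1 := by
  have h₁ : i.π F = i.π F * i.π F := i.map_conv F F F fun s => by
    rw [hF]
    exact DRGroupoid.conv_indicator_unitSet D s
  have h₂ : i.π F = star (i.π F) := i.map_involution F F fun s => by
    rw [hF]
    refine DRGroupoid.involution_indicator (fun s => ?_) s
    constructor
    · rintro ⟨hd, hr, hD⟩
      exact ⟨neg_eq_zero.2 hd, hr.symm, (hr ▸ hD : s.source ∈ D)⟩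
    · rintro ⟨hd, hr, hD⟩
      have hr' : s.range = s.source := hr.symm
      exact ⟨neg_eq_zero.1 hd, hr', hr' ▸ (hD : s.source ∈ D)⟩
  have h₃ : ‖i.π F‖ = ‖i.π F‖ * ‖i.π F‖ := by
    rw [← CStarRing.norm_star_mul_self, ← h₂, ← h₁]
  nlinarith [norm_nonneg (i.π F)]

theorem exists_isCharFun_unitSet [CompactSpace X] [T2Space X] {D : Set X} (hD : IsClopen D) :
    ∃ a : GroupoidCStar σ, IsCharFun a (DRGroupoid.unitSet σ D) := by
  have hc : IsCompact (DRGroupoid.unitSet σ D) := by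
    rw [DRGroupoid.unitSet_eq_image]
    exact hD.isClosed.isCompact.image DRGroupoid.continuous_unit
  obtain ⟨F, hF⟩ := exists_compactlySupported_indicator hc (DRGroupoid.isOpen_unitSet hD.isOpen)
  exact exists_isCharFun hF (GroupoidRep.norm_indicator_unitSet_le hF)

theorem exists_isCharFun_shiftSet [CompactSpace X] [T2Space X] (hσ : Continuous σ) {D : Set X}
    (hD : IsClopen D) (hinj : Set.InjOn σ D) :
    ∃ a : GroupoidCStar σ, IsCharFun a (DRGroupoid.shiftSet σ D) := by
  have hc₀ : IsCompact (DRGroupoid.unitSet σ D) := by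
    rw [DRGroupoid.unitSet_eq_image]
    exact hD.isClosed.isCompact.image DRGroupoid.continuous_unit
  have hc : IsCompact (DRGroupoid.shiftSet σ D) := by
    rw [DRGroupoid.shiftSet_eq_image]
    exact hD.isClosed.isCompact.image (DRGroupoid.continuous_shift hσ)
  have hc' : IsCompact (DRGroupoid.coshiftSet σ D) := by
    rw [DRGroupoid.coshiftSet_eq_image]
    exact hc.image DRGroupoid.continuous_inv
  obtain ⟨E, hE⟩ := exists_compactlySupported_indicator hc₀ (DRGroupoid.isOpen_unitSet hD.isOpen)
  obtain ⟨F, hF⟩ := exists_compactlySupported_indicator hc (DRGroupoid.isOpen_shiftSet hD.isOpen)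
  obtain ⟨F', hF'⟩ :=
    exists_compactlySupported_indicator hc' (DRGroupoid.isOpen_coshiftSet hD.isOpen)
  refine exists_isCharFun hF (C := 1) fun i => ?_
  have h₁ : i.π E = i.π F * i.π F' := i.map_conv F F' E fun s => by
    rw [hE, hF, hF']
    exact DRGroupoid.conv_indicator_shiftSet hinj s
  have h₂ : i.π F' = star (i.π F) := i.map_involution F F' fun s => by
    rw [hF, hF']
    refine DRGroupoid.involution_indicator (fun s => ?_) s
    exact ⟨fun h => ⟨neg_eq_iff_eq_neg.2 h.1, h.2.1.symm, h.2.2⟩,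
      fun h => ⟨neg_eq_iff_eq_neg.1 h.1, h.2.1.symm, h.2.2⟩⟩
  -- The product $\pi(F)\pi(F)^*$ is the image of the characteristic function of a set of units,
  -- already bounded by 1.
  have h₃ : ‖i.π F‖ * ‖i.π F‖ ≤ 1 := by
    rw [← CStarRing.norm_self_mul_star, ← h₂, ← h₁]
    exact i.norm_indicator_unitSet_le hE
  nlinarith [norm_nonneg (i.π F)]

end CharFun

/-! ### The shift space of a `λ`-graph bisystem -/

section ShiftSpace

variable {V : ℕ → Type u} {Sm Sp : Type u} {Lm : UpwardDiagram V Sm} {Lp : DownwardDiagram V Sp}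

theorem IsLambdaGraphBisystem.reverse (hL : IsLambdaGraphBisystem Lm Lp) :
    IsLambdaGraphBisystem Lp.reverse Lm.reverse where
  finite_vertex := hL.finite_vertex
  finite_edge_minus := hL.finite_edge_plus
  finite_edge_plus := hL.finite_edge_minus
  exists_minus_tgt := hL.exists_plus_src
  exists_minus_src := hL.exists_plus_tgt
  exists_plus_src := hL.exists_minus_tgt
  exists_plus_tgt := hL.exists_minus_src
  right_resolving := hL.left_resolving
  left_resolving := hL.right_resolving
  local_property l a b := by
    -- Reversal exchanges the two kinds of length-two paths between `a` and `b`, so the inverse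
    -- bijection serves.
    obtain ⟨φ, hφ⟩ := hL.local_property l a b
    refine ⟨φ.symm, fun p => ?_⟩
    have h := hφ (φ.symm p)
    have hp : φ (φ.symm p) = p := φ.apply_symm_apply p
    rw [hp] at h
    exact ⟨h.2.symm, h.1.symm⟩

/-! ### Topology of the path space and of the continuous graph -/

namespace OmegaMinus

/-- The vertex $u_0$ is read off a chosen path; right-resolving makes its first edge, hence $u_0$,
depend only on $(u_1,\beta_{-1})$. -/
theorem vertex_zero_eq
    (hr : ∀ e f : Lm.Edge 0, Lm.src e = Lm.src f → Lm.lab e = Lm.lab f → e = f)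
    (ω : OmegaMinus Lm) {e : Lm.Edge 0} (hs : Lm.src e = (ω.1 0).1) (hl : Lm.lab e = (ω.1 0).2) :
    ω.vertex 0 = Lm.tgt e := by
  have h := ω.2.choose_spec 0
  exact congrArg Lm.tgt (hr _ e (h.1.trans hs.symm) (h.2.1.trans hl.symm))

theorem continuous_coord (n : ℕ) :
    @Continuous (OmegaMinus Lm) (V (n + 1) × Sm) _ ⊥ fun ω => ω.1 n := by
  let : ∀ n, TopologicalSpace (V (n + 1) × Sm) := fun _ => ⊥
  exact (continuous_apply n).comp continuous_induced_dom

theorem continuous_comp_coord {Z : Type*} [TopologicalSpace Z] (n : ℕ) (f : V (n + 1) × Sm → Z) :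
    Continuous fun ω : OmegaMinus Lm => f (ω.1 n) :=
  let : TopologicalSpace (V (n + 1) × Sm) := ⊥
  continuous_bot.comp (continuous_coord n)

theorem continuous_vertex
    (hr : ∀ e f : Lm.Edge 0, Lm.src e = Lm.src f → Lm.lab e = Lm.lab f → e = f) (l : ℕ)
    [TopologicalSpace (V l)] [DiscreteTopology (V l)] :
    Continuous fun ω : OmegaMinus Lm => ω.vertex l := by
  cases l with
  | succ n => exact continuous_comp_coord n Prod.fst
  | zero =>
    refine continuous_discrete_rng.2 fun v => ?_
    let : TopologicalSpace (V 1 × Sm) := ⊥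
    have : DiscreteTopology (V 1 × Sm) := ⟨rfl⟩
    have h := (isOpen_discrete {p : V 1 × Sm | ∃ e : Lm.Edge 0,
      Lm.src e = p.1 ∧ Lm.lab e = p.2 ∧ Lm.tgt e = v}).preimage (continuous_coord (Lm := Lm) 0)
    convert! h using 1
    ext ω
    constructor
    · intro hω
      have h := ω.2.choose_spec 0
      exact ⟨_, h.1, h.2.1, hω⟩
    · rintro ⟨e, hs, hl, he⟩
      exact (ω.vertex_zero_eq hr hs hl).trans he

instance : T2Space (OmegaMinus Lm) := by
  let : ∀ n, TopologicalSpace (V (n + 1) × Sm) := fun _ => ⊥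
  have : ∀ n, DiscreteTopology (V (n + 1) × Sm) := fun _ => ⟨rfl⟩
  exact T2Space.of_injective_continuous (f := fun ω : OmegaMinus Lm => ω.1)
    Subtype.val_injective continuous_induced_dom

/-- The edge paths form a closed subset of a product of finite discrete sets, and they map
continuously onto the path space. -/
theorem compactSpace (hE : ∀ l, Finite (Lm.Edge l)) : CompactSpace (OmegaMinus Lm) := by
  let : ∀ n, TopologicalSpace (Lm.Edge n) := fun _ => ⊥
  have : ∀ n, DiscreteTopology (Lm.Edge n) := fun _ => ⟨rfl⟩
  let : ∀ n, TopologicalSpace (V (n + 1) × Sm) := fun _ => ⊥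
  let K : Set (∀ n, Lm.Edge n) := {e | ∀ n, Lm.tgt (e (n + 1)) = Lm.src (e n)}
  have hK : IsClosed K := by
    simp only [K, Set.ofPred_forall]
    refine isClosed_iInter fun n => ?_
    exact (isClosed_discrete {p : Lm.Edge (n + 1) × Lm.Edge n | Lm.tgt p.1 = Lm.src p.2}).preimage
      ((continuous_apply (n + 1)).prodMk (continuous_apply n))
  have : CompactSpace K := isCompact_iff_compactSpace.1 hK.isCompact
  let F : K → OmegaMinus Lm := fun e =>
    ⟨fun n => (Lm.src (e.1 n), Lm.lab (e.1 n)), e.1, fun n => ⟨rfl, rfl, e.2 n⟩⟩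
  have hF : Continuous F := by
    refine continuous_induced_rng.2 (continuous_pi fun n => ?_)
    exact (continuous_of_discreteTopology (f := fun e : Lm.Edge n => (Lm.src e, Lm.lab e))).comp
      ((continuous_apply n).comp continuous_subtype_val)
  suffices hs : Function.Surjective F from hs.compactSpace hF
  rintro ⟨ω, e, he⟩
  exact ⟨⟨e, fun n => (he n).2.2.trans (he n).1.symm⟩,
    Subtype.ext (funext fun n => Prod.ext (he n).1 (he n).2.1)⟩

end OmegaMinus

theorem GraphPlus.left_unique
    (hl : ∀ l (e f : Lp.Edge l), Lp.tgt e = Lp.tgt f → Lp.lab e = Lp.lab f → e = f)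
    {ω₁ ω₂ ω' : OmegaMinus Lm} {α : Sp} (h₁ : GraphPlus Lm Lp ω₁ α ω')
    (h₂ : GraphPlus Lm Lp ω₂ α ω') : ω₁ = ω₂ := by
  refine Subtype.ext (funext fun n => Prod.ext ?_ ((h₁.1 n).symm.trans (h₂.1 n)))
  -- Coordinate `n` of a path stores the vertex at level `n + 1`, hence the edge at that level.
  obtain ⟨e, hel, hes, het⟩ := h₁.2 (n + 1)
  obtain ⟨f, hfl, hfs, hft⟩ := h₂.2 (n + 1)
  obtain rfl := hl _ e f (het.trans hft.symm) (hel.trans hfl.symm)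
  exact hes.symm.trans hfs

theorem isClosed_graphPlus
    (hr : ∀ e f : Lm.Edge 0, Lm.src e = Lm.src f → Lm.lab e = Lm.lab f → e = f)
    [TopologicalSpace Sp] [DiscreteTopology Sp] :
    IsClosed {p : OmegaMinus Lm × Sp × OmegaMinus Lm | GraphPlus Lm Lp p.1 p.2.1 p.2.2} := by
  let : TopologicalSpace Sm := ⊥
  have : DiscreteTopology Sm := ⟨rfl⟩
  let : ∀ n, TopologicalSpace (V n) := fun _ => ⊥
  have : ∀ n, DiscreteTopology (V n) := fun _ => ⟨rfl⟩
  simp only [GraphPlus, Set.ofPred_and, Set.ofPred_forall]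
  refine (isClosed_iInter fun n => ?_).inter (isClosed_iInter fun l => ?_)
  · exact isClosed_eq
      ((OmegaMinus.continuous_comp_coord (n + 1) Prod.snd).comp (continuous_snd.comp continuous_snd))
      ((OmegaMinus.continuous_comp_coord n Prod.snd).comp continuous_fst)
  · exact (isClosed_discrete {q : Sp × V l × V (l + 1) |
        ∃ e : Lp.Edge l, Lp.lab e = q.1 ∧ Lp.src e = q.2.1 ∧ Lp.tgt e = q.2.2}).preimage
      ((continuous_fst.comp continuous_snd).prodMk
        (((OmegaMinus.continuous_vertex hr l).comp continuous_fst).prodMk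
          ((OmegaMinus.continuous_vertex hr (l + 1)).comp (continuous_snd.comp continuous_snd))))

/-! ### Topology of the shift space -/

namespace XPlus

theorem graphPlus_initial (x : XPlus Lm Lp) : GraphPlus Lm Lp x.initial (x.1 0).1 (x.1 0).2 :=
  x.2.2.choose_spec

theorem initial_label (x : XPlus Lm Lp) (n : ℕ) :
    (x.initial.1 n).2 = ((x.1 0).2.1 (n + 1)).2 :=
  (x.graphPlus_initial.1 n).symm

/-- This rewrites a condition on the chosen $\omega^0$ as one on $\alpha_1$ and the vertex
$u^1_{l+1}$, which shows that it is clopen. -/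
theorem initial_vertex_eq_iff
    (hl : ∀ l (e f : Lp.Edge l), Lp.tgt e = Lp.tgt f → Lp.lab e = Lp.lab f → e = f)
    (x : XPlus Lm Lp) (l : ℕ) (v : V l) : x.initial.vertex l = v ↔
      ∃ e : Lp.Edge l, Lp.lab e = (x.1 0).1 ∧ Lp.src e = v ∧ Lp.tgt e = ((x.1 0).2.1 l).1 := by
  obtain ⟨e, hel, hes, het⟩ := x.graphPlus_initial.2 l
  constructor
  · intro h
    exact ⟨e, hel, hes.trans h, het⟩
  · rintro ⟨f, hfl, hfs, hft⟩
    obtain rfl := hl _ e f (het.trans hft.symm) (hel.trans hfl.symm)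
    exact hes.symm.trans hfs

theorem continuous_coord_snd (i : ℕ) : Continuous fun x : XPlus Lm Lp => (x.1 i).2 := by
  let : TopologicalSpace Sp := ⊥
  exact continuous_snd.comp ((continuous_apply i).comp continuous_induced_dom)

theorem continuous_coord_fst [TopologicalSpace Sp] [DiscreteTopology Sp] (i : ℕ) :
    Continuous fun x : XPlus Lm Lp => (x.1 i).1 := by
  obtain rfl := DiscreteTopology.eq_bot (α := Sp)
  let : TopologicalSpace Sp := ⊥
  exact continuous_fst.comp ((continuous_apply i).comp continuous_induced_dom)

instance : T2Space (XPlus Lm Lp) := by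
  let : TopologicalSpace Sp := ⊥
  have : DiscreteTopology Sp := ⟨rfl⟩
  exact T2Space.of_injective_continuous (f := fun x : XPlus Lm Lp => x.1)
    Subtype.val_injective continuous_induced_dom

theorem continuous_rng {Z : Type*} [TopologicalSpace Z] {f : Z → XPlus Lm Lp}
    [TopologicalSpace Sp] [DiscreteTopology Sp] (h₁ : ∀ i, Continuous fun z => ((f z).1 i).1)
    (h₂ : ∀ i, Continuous fun z => ((f z).1 i).2) : Continuous f := by
  obtain rfl := DiscreteTopology.eq_bot (α := Sp)
  let : TopologicalSpace Sp := ⊥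
  exact continuous_induced_rng.2 (continuous_pi fun i => (h₁ i).prodMk (h₂ i))

theorem compactSpace [Finite Sp] (hE : ∀ l, Finite (Lm.Edge l))
    (hr : ∀ e f : Lm.Edge 0, Lm.src e = Lm.src f → Lm.lab e = Lm.lab f → e = f) :
    CompactSpace (XPlus Lm Lp) := by
  let : TopologicalSpace Sp := ⊥
  have : DiscreteTopology Sp := ⟨rfl⟩
  have := OmegaMinus.compactSpace hE
  have hG := isClosed_graphPlus (Lp := Lp) hr
  have hS : IsClosed {x : ℕ → Sp × OmegaMinus Lm |
      (∀ i, GraphPlus Lm Lp (x i).2 (x (i + 1)).1 (x (i + 1)).2) ∧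
        ∃ ω₀, GraphPlus Lm Lp ω₀ (x 0).1 (x 0).2} := by
    rw [Set.ofPred_and, Set.ofPred_forall]
    refine (isClosed_iInter fun i => ?_).inter ?_
    · have hf : Continuous fun x : ℕ → Sp × OmegaMinus Lm => ((x i).2, x (i + 1)) :=
        (continuous_apply i).snd.prodMk (continuous_apply (i + 1))
      exact hG.preimage hf
    -- The existence of $\omega^0$ is a closed condition because projection along the compact path
    -- space is a closed map.
    · convert! (isClosedMap_snd_of_compactSpace _ hG).preimage
        (continuous_apply (A := fun _ : ℕ => Sp × OmegaMinus Lm) 0) using 1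
      ext x
      constructor
      · rintro ⟨ω, h⟩
        exact ⟨(ω, x 0), h, rfl⟩
      · rintro ⟨⟨ω, y⟩, h, hy⟩
        obtain rfl : y = x 0 := hy
        exact ⟨ω, h⟩
  exact isCompact_iff_compactSpace.1 hS.isCompact

theorem continuous_shiftPlus : Continuous (shiftPlus Lm Lp) := by
  let : TopologicalSpace Sp := ⊥
  have : DiscreteTopology Sp := ⟨rfl⟩
  exact continuous_rng (fun i => continuous_coord_fst (i + 1)) fun i => continuous_coord_snd (i + 1)

theorem isClopen_label (α : Sp) : IsClopen {x : XPlus Lm Lp | (x.1 0).1 = α} := by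
  let : TopologicalSpace Sp := ⊥
  have : DiscreteTopology Sp := ⟨rfl⟩
  exact (isClopen_discrete {α}).preimage (continuous_coord_fst 0)

/-- Only the first entry is lost by the shift: its label is prescribed, and its path is recovered
from the next entry by left-resolving. -/
theorem injOn_shiftPlus
    (hl : ∀ l (e f : Lp.Edge l), Lp.tgt e = Lp.tgt f → Lp.lab e = Lp.lab f → e = f) (α : Sp) :
    Set.InjOn (shiftPlus Lm Lp) {x | (x.1 0).1 = α} := by
  intro x hx y hy h
  have hxy : ∀ i, x.1 (i + 1) = y.1 (i + 1) := fun i => congrFun (congrArg Subtype.val h) i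
  refine Subtype.ext (funext fun i => ?_)
  cases i with
  | succ i => exact hxy i
  | zero =>
    have hx₀ := x.2.1 0
    rw [hxy 0] at hx₀
    exact Prod.ext (hx.trans hy.symm) (hx₀.left_unique hl (y.2.1 0))

theorem isClopen_initial
    (hl : ∀ l (e f : Lp.Edge l), Lp.tgt e = Lp.tgt f → Lp.lab e = Lp.lab f → e = f)
    {l : ℕ} (v : V l) (ξ : Fin l → Sm) :
    IsClopen {x : XPlus Lm Lp | x.initial.vertex l = v ∧
      ∀ k : Fin l, (x.initial.1 (Fin.rev k : Fin l)).2 = ξ k} := by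
  let : TopologicalSpace Sp := ⊥
  have : DiscreteTopology Sp := ⟨rfl⟩
  let : TopologicalSpace Sm := ⊥
  have : DiscreteTopology Sm := ⟨rfl⟩
  let : TopologicalSpace (V (l + 1)) := ⊥
  have : DiscreteTopology (V (l + 1)) := ⟨rfl⟩
  simp only [initial_vertex_eq_iff hl, initial_label, Set.ofPred_and, Set.ofPred_forall]
  refine IsClopen.inter ?_ (isClopen_iInter_of_finite fun k => ?_)
  · exact (isClopen_discrete {q : Sp × V (l + 1) |
        ∃ e : Lp.Edge l, Lp.lab e = q.1 ∧ Lp.src e = v ∧ Lp.tgt e = q.2}).preimage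
      ((continuous_coord_fst 0).prodMk
        ((OmegaMinus.continuous_comp_coord l Prod.fst).comp (continuous_coord_snd 0)))
  · exact (isClopen_discrete {ξ k}).preimage
      ((OmegaMinus.continuous_comp_coord _ Prod.snd).comp (continuous_coord_snd 0))

end XPlus

theorem exists_isGeneratorS [Finite Sp] (hL : IsLambdaGraphBisystem Lm Lp) (α : Sp) :
    ∃ a, IsGeneratorS Lm Lp α a :=
  have := XPlus.compactSpace (Lp := Lp) hL.finite_edge_minus (hL.right_resolving 0)
  exists_isCharFun_shiftSet XPlus.continuous_shiftPlus (XPlus.isClopen_label α)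
    (XPlus.injOn_shiftPlus hL.left_resolving α)

theorem exists_isProjectionMinus [Finite Sp] (hL : IsLambdaGraphBisystem Lm Lp) {l : ℕ} (v : V l)
    (ξ : Fin l → Sm) : ∃ a, IsProjectionMinus Lm Lp v ξ a :=
  have := XPlus.compactSpace (Lp := Lp) hL.finite_edge_minus (hL.right_resolving 0)
  exists_isCharFun_unitSet (XPlus.isClopen_initial hL.left_resolving v ξ)

/-! ### Reversal of the edges -/

/-- Reversal of the edges identifies `Ω_{L⁺}` of the reversed diagram with `Ω_{L⁻}`. -/
def OmegaPlus.reverseHomeomorph (Lm : UpwardDiagram V Sm) :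
    OmegaPlus Lm.reverse ≃ₜ OmegaMinus Lm where
  toFun ω := ⟨fun n => (ω.1 n).swap, by
    obtain ⟨e, he⟩ := ω.2
    exact ⟨e, fun n => ⟨(he n).2.1, (he n).1, (he n).2.2⟩⟩⟩
  invFun ω := ⟨fun n => (ω.1 n).swap, by
    obtain ⟨e, he⟩ := ω.2
    exact ⟨e, fun n => ⟨(he n).2.1, (he n).1, (he n).2.2⟩⟩⟩
  left_inv _ := rfl
  right_inv _ := rfl
  continuous_toFun := by
    let : ∀ n, TopologicalSpace (V (n + 1) × Sm) := fun _ => ⊥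
    let : ∀ n, TopologicalSpace (Sm × V (n + 1)) := fun _ => ⊥
    refine continuous_induced_rng.2 (continuous_pi fun n => ?_)
    have h : Continuous fun ω : OmegaPlus Lm.reverse => ω.1 n :=
      (continuous_apply n).comp continuous_induced_dom
    exact (continuous_bot (f := Prod.swap)).comp h
  continuous_invFun := by
    let : ∀ n, TopologicalSpace (V (n + 1) × Sm) := fun _ => ⊥
    let : ∀ n, TopologicalSpace (Sm × V (n + 1)) := fun _ => ⊥
    refine continuous_induced_rng.2 (continuous_pi fun n => ?_)
    have h : Continuous fun ω : OmegaMinus Lm => ω.1 n :=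
      (continuous_apply n).comp continuous_induced_dom
    exact (continuous_bot (f := Prod.swap)).comp h

theorem OmegaPlus.vertex_reverseHomeomorph
    (hr : ∀ e f : Lm.Edge 0, Lm.src e = Lm.src f → Lm.lab e = Lm.lab f → e = f)
    (ω : OmegaPlus Lm.reverse) (l : ℕ) :
    (OmegaPlus.reverseHomeomorph Lm ω).vertex l = ω.vertex l := by
  cases l with
  | succ n => rfl
  | zero =>
    have h := ω.2.choose_spec 0
    exact OmegaMinus.vertex_zero_eq hr (e := ω.2.choose 0) _ h.2.1 h.1

theorem graphPlus_reverseHomeomorph_iff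
    (hr : ∀ e f : Lm.Edge 0, Lm.src e = Lm.src f → Lm.lab e = Lm.lab f → e = f)
    {ω ω' : OmegaPlus Lm.reverse} {α : Sp} :
    GraphPlus Lm Lp (OmegaPlus.reverseHomeomorph Lm ω) α (OmegaPlus.reverseHomeomorph Lm ω') ↔
      GraphMinus Lp.reverse Lm.reverse ω α ω' := by
  unfold GraphPlus
  simp only [OmegaPlus.vertex_reverseHomeomorph hr]
  exact Iff.rfl

/-- Reversal of the edges identifies the shift spaces `X⁻_{L⁺}` of the reversed bisystem
and `X⁺_{L⁻}`. -/
def XMinus.reverseHomeomorph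
    (hr : ∀ e f : Lm.Edge 0, Lm.src e = Lm.src f → Lm.lab e = Lm.lab f → e = f) :
    XMinus Lp.reverse Lm.reverse ≃ₜ XPlus Lm Lp where
  toFun x := ⟨fun i => ((x.1 i).1, OmegaPlus.reverseHomeomorph Lm (x.1 i).2),
    fun i => (graphPlus_reverseHomeomorph_iff hr).2 (x.2.1 i),
    x.2.2.imp' (OmegaPlus.reverseHomeomorph Lm) fun _ h => (graphPlus_reverseHomeomorph_iff hr).2 h⟩
  invFun x := ⟨fun i => ((x.1 i).1, (OmegaPlus.reverseHomeomorph Lm).symm (x.1 i).2),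
    fun i => (graphPlus_reverseHomeomorph_iff hr).1 (x.2.1 i),
    x.2.2.imp' (OmegaPlus.reverseHomeomorph Lm).symm fun _ h =>
      (graphPlus_reverseHomeomorph_iff hr).1 h⟩
  left_inv _ := rfl
  right_inv _ := rfl
  continuous_toFun := by
    let : TopologicalSpace Sp := ⊥
    refine continuous_induced_rng.2 (continuous_pi fun i => ?_)
    have h : Continuous fun x : XMinus Lp.reverse Lm.reverse => x.1 i :=
      (continuous_apply i).comp continuous_induced_dom
    exact (continuous_fst.comp h).prodMk
      ((OmegaPlus.reverseHomeomorph Lm).continuous.comp (continuous_snd.comp h))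
  continuous_invFun := by
    let : TopologicalSpace Sp := ⊥
    refine continuous_induced_rng.2 (continuous_pi fun i => ?_)
    have h : Continuous fun x : XPlus Lm Lp => x.1 i :=
      (continuous_apply i).comp continuous_induced_dom
    exact (continuous_fst.comp h).prodMk
      ((OmegaPlus.reverseHomeomorph Lm).symm.continuous.comp (continuous_snd.comp h))

theorem XMinus.reverseHomeomorph_shiftMinus
    (hr : ∀ e f : Lm.Edge 0, Lm.src e = Lm.src f → Lm.lab e = Lm.lab f → e = f)
    (x : XMinus Lp.reverse Lm.reverse) :
    XMinus.reverseHomeomorph hr (shiftMinus Lp.reverse Lm.reverse x) =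
      shiftPlus Lm Lp (XMinus.reverseHomeomorph hr x) :=
  rfl

/-- Both sides precede the same first entry in the continuous graph, and such a predecessor is
unique. -/
theorem XMinus.initial_reverseHomeomorph (hL : IsLambdaGraphBisystem Lm Lp)
    (x : XMinus Lp.reverse Lm.reverse) :
    (XMinus.reverseHomeomorph (hL.right_resolving 0) x : XPlus Lm Lp).initial =
      OmegaPlus.reverseHomeomorph Lm x.initial :=
  (XPlus.graphPlus_initial _).left_unique hL.left_resolving
    ((graphPlus_reverseHomeomorph_iff (hL.right_resolving 0)).2 x.2.2.choose_spec)

/-- Reversal of the edges induces an isomorphism `O⁺_{L⁻} ≃ O⁻_{L⁻ᵗ}`. -/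
noncomputable def IsLambdaGraphBisystem.reverseEquiv (hL : IsLambdaGraphBisystem Lm Lp) :
    OPlus Lm Lp ≃⋆ₐ[ℂ] OMinus Lp.reverse Lm.reverse :=
  GroupoidCStar.congr (XMinus.reverseHomeomorph (hL.right_resolving 0))
    (XMinus.reverseHomeomorph_shiftMinus (hL.right_resolving 0))

theorem IsLambdaGraphBisystem.isGeneratorT_reverseEquiv (hL : IsLambdaGraphBisystem Lm Lp) {α : Sp}
    {a : OPlus Lm Lp} (h : IsGeneratorS Lm Lp α a) :
    IsGeneratorT Lp.reverse Lm.reverse α (hL.reverseEquiv a) := by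
  unfold IsGeneratorT
  convert! IsCharFun.congr (XMinus.reverseHomeomorph (hL.right_resolving 0))
    (XMinus.reverseHomeomorph_shiftMinus (hL.right_resolving 0)) h using 1
  ext g
  -- The conjugacy is injective and intertwines the shifts, so the equation between shifted range
  -- and source may be tested after applying it.
  exact and_congr Iff.rfl (and_congr
    (XMinus.reverseHomeomorph (hL.right_resolving 0)).injective.eq_iff.symm Iff.rfl)

theorem IsLambdaGraphBisystem.isProjectionPlus_reverseEquiv (hL : IsLambdaGraphBisystem Lm Lp)
    {l : ℕ} {v : V l} {ξ : Fin l → Sm} {a : OPlus Lm Lp} (h : IsProjectionMinus Lm Lp v ξ a) :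
    IsProjectionPlus Lp.reverse Lm.reverse v (fun k => ξ (Fin.rev k)) (hL.reverseEquiv a) := by
  unfold IsProjectionPlus
  convert! IsCharFun.congr (XMinus.reverseHomeomorph (hL.right_resolving 0))
    (XMinus.reverseHomeomorph_shiftMinus (hL.right_resolving 0)) h using 1
  ext g
  refine and_congr Iff.rfl (and_congr
    (XMinus.reverseHomeomorph (hL.right_resolving 0)).injective.eq_iff.symm ?_)
  have hi := XMinus.initial_reverseHomeomorph hL g.range
  change _ ↔ (XMinus.reverseHomeomorph (hL.right_resolving 0) g.range).initial.vertex l = v ∧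
    ∀ k : Fin l, ((XMinus.reverseHomeomorph (hL.right_resolving 0) g.range).initial.1
      (Fin.rev k : Fin l)).2 = ξ k
  rw [hi, OmegaPlus.vertex_reverseHomeomorph (hL.right_resolving 0)]
  -- Words are read towards level 0 in one algebra and away from it in the other; reindexing by
  -- `Fin.rev` reconciles them.
  refine and_congr Iff.rfl (Fin.revPerm.forall_congr fun {k} => ?_)
  rw [Fin.revPerm_apply, Fin.rev_rev]
  exact Iff.rfl

end ShiftSpace

theorem mainTheorem9 {V : ℕ → Type u} {Sm Sp : Type u} [Finite Sm] [Finite Sp]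
    (Lm : UpwardDiagram V Sm) (Lp : DownwardDiagram V Sp) (hL : IsLambdaGraphBisystem Lm Lp) :
    IsLambdaGraphBisystem Lp.reverse Lm.reverse ∧
    (∃ Φ : OPlus Lm Lp ≃⋆ₐ[ℂ] OMinus Lp.reverse Lm.reverse,
      (∀ α : Sp, ∃ a, IsGeneratorS Lm Lp α a ∧
        IsGeneratorT Lp.reverse Lm.reverse α (Φ a)) ∧
      ∀ (l : ℕ) (v : V l) (ξ : Fin l → Sm), ∃ a, IsProjectionMinus Lm Lp v ξ a ∧
        IsProjectionPlus Lp.reverse Lm.reverse v (fun k => ξ (Fin.rev k)) (Φ a)) ∧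
    (∃ Ψ : OMinus Lm Lp ≃⋆ₐ[ℂ] OPlus Lp.reverse Lm.reverse,
      (∀ β : Sm, ∃ a, IsGeneratorT Lm Lp β a ∧
        IsGeneratorS Lp.reverse Lm.reverse β (Ψ a)) ∧
      ∀ (l : ℕ) (v : V l) (η : Fin l → Sp), ∃ a, IsProjectionPlus Lm Lp v η a ∧
        IsProjectionMinus Lp.reverse Lm.reverse v (fun k => η (Fin.rev k)) (Ψ a)) := by
  refine ⟨hL.reverse, ⟨hL.reverseEquiv, fun α => ?_, fun l v ξ => ?_⟩,
    ⟨hL.reverse.reverseEquiv.symm, fun β => ?_, fun l v η => ?_⟩⟩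
  · obtain ⟨a, ha⟩ := exists_isGeneratorS hL α
    exact ⟨a, ha, hL.isGeneratorT_reverseEquiv ha⟩
  · obtain ⟨a, ha⟩ := exists_isProjectionMinus hL v ξ
    exact ⟨a, ha, hL.isProjectionPlus_reverseEquiv ha⟩
  · obtain ⟨a, ha⟩ := exists_isGeneratorS hL.reverse β
    refine ⟨hL.reverse.reverseEquiv a, hL.reverse.isGeneratorT_reverseEquiv ha, ?_⟩
    exact (congrArg (IsGeneratorS Lp.reverse Lm.reverse β)
      (hL.reverse.reverseEquiv.symm_apply_apply a)).mpr ha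
  -- The element is built on the target side from the reversed word, so that its image in the source
  -- algebra carries the twice reversed word, which is `η`.
  · obtain ⟨a, ha⟩ := exists_isProjectionMinus hL.reverse v fun k => η (Fin.rev k)
    refine ⟨hL.reverse.reverseEquiv a, ?_, ?_⟩
    · have h := hL.reverse.isProjectionPlus_reverseEquiv ha
      simp only [Fin.rev_rev] at h
      exact h
    · exact (congrArg (IsProjectionMinus Lp.reverse Lm.reverse v fun k => η (Fin.rev k))
        (hL.reverse.reverseEquiv.symm_apply_apply a)).mpr ha
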